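/- Formulas are built from a countably infinite set of propositional variables by $\bot,\wedge,\vee,\to,\Box,\Diamond$. For a set $\mathsf{Ax}$ of formulas, $\Gamma\vdash_{\mathsf{Ax}}\varphi$ (provability in $\mathsf{CK}\oplus\mathsf{Ax}$, for a set $\Gamma$ of formulas, possibly infinite, and a formula $\varphi$) is generated by the rules: $\Gamma\vdash\varphi$ if $\varphi$ is a substitution instance of an axiom of intuitionistic propositional logic, of $\Box(p\to q)\to(\Box p\to\Box q)$, of $\Box(p\to q)\to(\Diamond p\to\Diamond q)$, or of a formula in $\mathsf{Ax}$; $\Gamma\vdash\varphi$ if $\varphi\in\Gamma$; modus ponens; and from $\emptyset\vdash\varphi$ infer $\Gamma\vdash\Box\varphi$. Consider the axioms $$\mathsf N_\Diamond:\ \Diamond\bot\to\bot,\qquad \mathsf C_\Diamond:\ \Diamond(p\vee q)\to\Diamond p\vee\Diamond q,\qquad \mathsf I_{\Diamond\Box}:\ (\Diamond p\to\Box q)\to\Box(p\to q).$$ A $\mathsf{CK}$-frame is a tuple $(X,e,\le,R)$ where $(X,\le)$ is a preorder, $e\in X$ is such that $e\le x$ implies $x=e$, and $R$ is a binary relation on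 $X$ with $e\mathrel Rx$ iff $x=e$. A valuation $V$ assigns to each variable an upset of $(X,\le)$ containing $e$. Truth at a world is defined by: $x\Vdash p$ iff $x\in V(p)$; $x\Vdash\bot$ iff $x=e$; $\wedge,\vee$ pointwise; $x\Vdash\varphi\to\psi$ iff for all $y\ge x$, $y\Vdash\varphi$ implies $y\Vdash\psi$; $x\Vdash\Box\varphi$ iff $z\Vdash\varphi$ whenever $x\le y\mathrel Rz$; $x\Vdash\Diamond\varphi$ iff for every $y\ge x$ there is $z$ with $y\mathrel Rz$ and $z\Vdash\varphi$. For a class $\mathcal F$ of $\mathsf{CK}$-frames, $\Gamma\Vdash_{\mathcal F}\varphi$ means that for every frame in $\mathcal F$, every valuation and every world $x$, if $x$ satisfies all of $\Gamma$ then $x\Vdash\varphi$. Consider the frame conditions - ($\mathsf N_\Diamond$-suff): for all $x$, $x\mathrel Re$ implies $x=e$; - ($\mathsf N_\Diamond$-corr): for all $x$, if $y\mathrel Re$ for all $y\ge x$, then $x=e$; - ($\mathsf C_\Diamond$-suff): for every $x$ there is $x'\ge x$ such that for all $y\ge x$ and all $z$ with $x'\mathrel Rz$ there is $w$ with $y\mathrel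 Rw$ and $z\le w$; - ($\mathsf I_{\Diamond\Box}$-suff): whenever $x\mathrel Ry\le z$, there is $u$ with $x\le u\mathrel Rz$ such that for every $s\ge u$ there is $t$ with $s\mathrel Rt$ and $z\le t$. **Theorem.** Let $\mathsf{Ax}\subseteq\{\mathsf N_\Diamond,\mathsf C_\Diamond,\mathsf I_{\Diamond\Box}\}$, and let $\mathcal F$ be the class of $\mathsf{CK}$-frames satisfying ($\mathsf A$-suff) for each $\mathsf A\in\mathsf{Ax}$, except that if $\mathsf{Ax}=\{\mathsf N_\Diamond\}$ or $\mathsf{Ax}=\{\mathsf N_\Diamond,\mathsf C_\Diamond\}$ then ($\mathsf N_\Diamond$-corr) replaces ($\mathsf N_\Diamond$-suff). Then $\mathsf{CK}\oplus\mathsf{Ax}$ is sound and strongly complete with respect to $\mathcal F$: for every set $\Gamma$ of formulas and every formula $\varphi$, $\Gamma\vdash_{\mathsf{Ax}}\varphi$ implies $\Gamma\Vdash_{\mathcal F}\varphi$, and $\Gamma\Vdash_{\mathcal F}\varphi$ implies $\Gamma\vdash_{\mathsf{Ax}}\varphi$. -/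

import Mathlib

universe u

namespace ConstructiveK

/-- Modal formulas over the countably infinite set `ℕ` of propositional variables. -/
inductive Form : Type
  | var (p : ℕ)
  | bot
  | and (φ ψ : Form)
  | or (φ ψ : Form)
  | imp (φ ψ : Form)
  | box (φ : Form)
  | dia (φ : Form)

namespace Form

/-- Uniform substitution. -/
def subst (σ : ℕ → Form) : Form → Form
  | var p => σ p
  | bot => bot
  | and φ ψ => and (φ.subst σ) (ψ.subst σ)
  | or φ ψ => or (φ.subst σ) (ψ.subst σ)
  | imp φ ψ => imp (φ.subst σ) (ψ.subst σ)
  | box φ => box (φ.subst σ)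
  | dia φ => dia (φ.subst σ)

end Form

/-- The set of all substitution instances of the formulas in `Ax`. -/
def Instances (Ax : Set Form) : Set Form :=
  {φ | ∃ A ∈ Ax, ∃ σ : ℕ → Form, φ = A.subst σ}

section Axioms

open Form

/-- A Hilbert axiomatisation of intuitionistic propositional logic (with modus ponens). -/
def IntAx : Set Form :=
  let p := var 0
  let q := var 1
  let r := var 2
  { imp p (imp q p),
    imp (imp p (imp q r)) (imp (imp p q) (imp p r)),
    imp p (imp q (and p q)),
    imp (and p q) p,
    imp (and p q) q,
    imp p (or p q),
    imp q (or p q),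
    imp (imp p r) (imp (imp q r) (imp (or p q) r)),
    imp bot p }

/-- `□(p → q) → (□p → □q)` -/
def axKbox : Form :=
  imp (box (imp (var 0) (var 1))) (imp (box (var 0)) (box (var 1)))

/-- `□(p → q) → (◇p → ◇q)` -/
def axKdia : Form :=
  imp (box (imp (var 0) (var 1))) (imp (dia (var 0)) (dia (var 1)))

/-- `◇⊥ → ⊥` -/
def axN : Form := imp (dia bot) bot

/-- `◇(p ∨ q) → ◇p ∨ ◇q` -/
def axC : Form :=
  imp (dia (or (var 0) (var 1))) (or (dia (var 0)) (dia (var 1)))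

/-- `(◇p → □q) → □(p → q)` -/
def axI : Form :=
  imp (imp (dia (var 0)) (box (var 1))) (box (imp (var 0) (var 1)))

/-- The axioms of `CK`. -/
def CKAx : Set Form := IntAx ∪ {axKbox, axKdia}

end Axioms

/-- `Provable Ax Γ φ`: the consecution `Γ ⊢ φ` is provable in the generalised
Hilbert calculus `CK ⊕ Ax`. -/
inductive Provable (Ax : Set Form) : Set Form → Form → Prop
  | ax {Γ : Set Form} {φ : Form} : φ ∈ Instances CKAx ∪ Instances Ax → Provable Ax Γ φ
  | mp {Γ : Set Form} {φ ψ : Form} :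
      Provable Ax Γ φ → Provable Ax Γ (Form.imp φ ψ) → Provable Ax Γ ψ
  | nec {Γ : Set Form} {φ : Form} : Provable Ax ∅ φ → Provable Ax Γ (Form.box φ)
  | el {Γ : Set Form} {φ : Form} : φ ∈ Γ → Provable Ax Γ φ

/-- A `CK`-frame: a preorder with a binary relation `R` and an exploding world `expl`
that has nothing above it except itself and whose only `R`-successor is itself. -/
structure CKFrame : Type (u + 1) where
  World : Type u
  [preorder : Preorder World]
  expl : World
  R : World → World → Prop
  eq_expl_of_le : ∀ x : World, expl ≤ x → x = expl
  expl_R_iff : ∀ x : World, R expl x ↔ x = expl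

attribute [instance] CKFrame.preorder

/-- A valuation assigns to each variable an upset that contains the exploding world. -/
structure Valuation (F : CKFrame.{u}) where
  val : ℕ → Set F.World
  isUpperSet : ∀ p, IsUpperSet (val p)
  expl_mem : ∀ p, F.expl ∈ val p

/-- Truth of a formula at a world of the model `(F, V)`. -/
def Forces (F : CKFrame.{u}) (V : Valuation F) : F.World → Form → Prop
  | x, .var p => x ∈ V.val p
  | x, .bot => x = F.expl
  | x, .and φ ψ => Forces F V x φ ∧ Forces F V x ψ
  | x, .or φ ψ => Forces F V x φ ∨ Forces F V x ψ
  | x, .imp φ ψ => ∀ y, x ≤ y → Forces F V y φ → Forces F V y ψ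
  | x, .box φ => ∀ y z, x ≤ y → F.R y z → Forces F V z φ
  | x, .dia φ => ∀ y, x ≤ y → ∃ z, F.R y z ∧ Forces F V z φ

/-- The frame `F` validates the consecution `Γ ⊢ φ`. -/
def CKFrame.Validates (F : CKFrame.{u}) (Γ : Set Form) (φ : Form) : Prop :=
  ∀ (V : Valuation F) (x : F.World), (∀ ψ ∈ Γ, Forces F V x ψ) → Forces F V x φ

/-- `Γ` semantically entails `φ` on the class `C` of frames. -/
def Entails (C : Set CKFrame.{u}) (Γ : Set Form) (φ : Form) : Prop :=
  ∀ F ∈ C, F.Validates Γ φ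

/-- The sufficient condition for `◇⊥ → ⊥`. -/
def NSuff (F : CKFrame.{u}) : Prop :=
  ∀ x, F.R x F.expl → x = F.expl

/-- The correspondence condition for `◇⊥ → ⊥`. -/
def NCorr (F : CKFrame.{u}) : Prop :=
  ∀ x, (∀ y, x ≤ y → F.R y F.expl) → x = F.expl

/-- The sufficient condition for `◇(p ∨ q) → ◇p ∨ ◇q`. -/
def CSuff (F : CKFrame.{u}) : Prop :=
  ∀ x, ∃ x', x ≤ x' ∧ ∀ y z, x ≤ y → F.R x' z → ∃ w, F.R y w ∧ z ≤ w

/-- The sufficient condition for `(◇p → □q) → □(p → q)`. -/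
def ISuff (F : CKFrame.{u}) : Prop :=
  ∀ x y z, F.R x y → y ≤ z →
    ∃ u, x ≤ u ∧ F.R u z ∧ ∀ s, u ≤ s → ∃ t, F.R s t ∧ z ≤ t

open Classical in
/-- The class of `CK`-frames attached to `Ax ⊆ {axN, axC, axI}`: each axiom in `Ax` imposes its
sufficient condition, except that for `Ax = {axN}` and `Ax = {axN, axC}` the axiom `axN` imposes
its correspondence condition instead. -/
def frameClass (Ax : Set Form) : Set CKFrame.{u} :=
  {F | (axN ∈ Ax → if Ax = {axN} ∨ Ax = {axN, axC} then NCorr F else NSuff F) ∧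
       (axC ∈ Ax → CSuff F) ∧
       (axI ∈ Ax → ISuff F)}

end ConstructiveK

/-! Soundness is induction on derivations. Completeness uses one canonical frame for all choices of
`Ax`. Its worlds are segments, ordered by their heads only, so one prime theory occurs with many
tails and a world can be replaced by an equivalent one with a better tail. This drives the modal
cases of `forces_canonical_iff`: `full` refutes a box, `avoiding` refutes a diamond.

Two clauses of `Segment` secure the frame conditions. `dia_mem` extends a whole theory inside the
tail, not just a single formula, as the `t` or `w` above `z` in `ISuff` and `CSuff` must contain all
of the head of `z`. `bot_mem` gives `NSuff` whenever `axN ∈ Ax`; since `NSuff` implies `NCorr`, the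
exceptional cases need nothing extra.

All prime theories come from `exists_isPrimeTheory`, a Lindenbaum lemma that avoids a directed set
of formulas at once. -/

namespace ConstructiveK

open Form

/-! ### Derivations -/

section Derivations

variable {Ax Γ Δ : Set Form} {φ ψ χ : Form}

/-- The substitution sending the first three variables to given formulas. -/
def subst₃ (φ ψ χ : Form) : ℕ → Form
  | 0 => φ
  | 1 => ψ
  | _ => χ

theorem Provable.of_int {A : Form} (hA : A ∈ IntAx) (φ ψ χ : Form) :
    Provable Ax Γ (A.subst (subst₃ φ ψ χ)) :=
  .ax (Or.inl ⟨A, Or.inl hA, _, rfl⟩)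

theorem Provable.of_mem_ax {A : Form} (hA : A ∈ Ax) (φ ψ χ : Form) :
    Provable Ax Γ (A.subst (subst₃ φ ψ χ)) :=
  .ax (Or.inr ⟨A, hA, _, rfl⟩)

theorem Provable.const (φ ψ : Form) : Provable Ax Γ (imp φ (imp ψ φ)) :=
  of_int (A := imp (var 0) (imp (var 1) (var 0))) (by simp [IntAx]) φ ψ ψ

theorem Provable.distrib (φ ψ χ : Form) :
    Provable Ax Γ (imp (imp φ (imp ψ χ)) (imp (imp φ ψ) (imp φ χ))) :=
  of_int (A := imp (imp (var 0) (imp (var 1) (var 2)))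
    (imp (imp (var 0) (var 1)) (imp (var 0) (var 2)))) (by simp [IntAx]) φ ψ χ

theorem Provable.pair (φ ψ : Form) : Provable Ax Γ (imp φ (imp ψ (and φ ψ))) :=
  of_int (A := imp (var 0) (imp (var 1) (and (var 0) (var 1)))) (by simp [IntAx]) φ ψ ψ

theorem Provable.fst (φ ψ : Form) : Provable Ax Γ (imp (and φ ψ) φ) :=
  of_int (A := imp (and (var 0) (var 1)) (var 0)) (by simp [IntAx]) φ ψ ψ

theorem Provable.snd (φ ψ : Form) : Provable Ax Γ (imp (and φ ψ) ψ) :=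
  of_int (A := imp (and (var 0) (var 1)) (var 1)) (by simp [IntAx]) φ ψ ψ

theorem Provable.inl (φ ψ : Form) : Provable Ax Γ (imp φ (or φ ψ)) :=
  of_int (A := imp (var 0) (or (var 0) (var 1))) (by simp [IntAx]) φ ψ ψ

theorem Provable.inr (φ ψ : Form) : Provable Ax Γ (imp ψ (or φ ψ)) :=
  of_int (A := imp (var 1) (or (var 0) (var 1))) (by simp [IntAx]) φ ψ ψ

theorem Provable.cases (φ ψ χ : Form) :
    Provable Ax Γ (imp (imp φ χ) (imp (imp ψ χ) (imp (or φ ψ) χ))) :=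
  of_int (A := imp (imp (var 0) (var 2)) (imp (imp (var 1) (var 2))
    (imp (or (var 0) (var 1)) (var 2)))) (by simp [IntAx]) φ ψ χ

theorem Provable.exfalso (φ : Form) : Provable Ax Γ (imp bot φ) :=
  of_int (A := imp bot (var 0)) (by simp [IntAx]) φ φ φ

theorem Provable.box_imp (φ ψ : Form) :
    Provable Ax Γ (imp (box (imp φ ψ)) (imp (box φ) (box ψ))) :=
  .ax (Or.inl ⟨axKbox, by simp [CKAx], subst₃ φ ψ ψ, rfl⟩)

theorem Provable.dia_imp (φ ψ : Form) :
    Provable Ax Γ (imp (box (imp φ ψ)) (imp (dia φ) (dia ψ))) :=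
  .ax (Or.inl ⟨axKdia, by simp [CKAx], subst₃ φ ψ ψ, rfl⟩)

theorem Provable.cut (h : Provable Ax Δ φ) (hΔ : ∀ δ ∈ Δ, Provable Ax Γ δ) :
    Provable Ax Γ φ := by
  induction h with
  | ax h => exact .ax h
  | mp _ _ ih₁ ih₂ => exact .mp (ih₁ hΔ) (ih₂ hΔ)
  | nec h _ => exact .nec h
  | el h => exact hΔ _ h

theorem Provable.mono (h : Provable Ax Δ φ) (hΔ : Δ ⊆ Γ) : Provable Ax Γ φ :=
  h.cut fun _ hδ => .el (hΔ hδ)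

theorem Provable.imp_self (φ : Form) : Provable Ax Γ (imp φ φ) :=
  .mp (const φ φ) (.mp (const φ (imp φ φ)) (distrib φ (imp φ φ) φ))

theorem Provable.weaken (h : Provable Ax Γ ψ) (φ : Form) : Provable Ax Γ (imp φ ψ) :=
  .mp h (const ψ φ)

/-- Necessitation applies only to theorems, so its conclusion never depends on the discharged
premise. -/
theorem Provable.deduction (h : Provable Ax (insert φ Γ) ψ) : Provable Ax Γ (imp φ ψ) := by
  generalize hΔ : insert φ Γ = Δ at h
  induction h with
  | ax h => exact weaken (.ax h) φ
  | mp _ _ ih₁ ih₂ => exact .mp (ih₁ hΔ) (.mp (ih₂ hΔ) (distrib _ _ _))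
  | nec h _ => exact weaken (.nec h) φ
  | el h =>
    subst hΔ
    rcases h with rfl | h
    · exact imp_self _
    · exact weaken (.el h) φ

theorem Provable.trans (h₁ : Provable Ax Γ (imp φ ψ)) (h₂ : Provable Ax Γ (imp ψ χ)) :
    Provable Ax Γ (imp φ χ) :=
  .mp h₁ (.mp (weaken h₂ φ) (distrib φ ψ χ))

theorem Provable.box_image (h : Provable Ax Γ φ) : Provable Ax (box '' Γ) (box φ) := by
  induction h with
  | ax h => exact .nec (.ax h)
  | mp _ _ ih₁ ih₂ => exact .mp ih₁ (.mp ih₂ (box_imp _ _))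
  | nec h _ => exact .nec (.nec h)
  | el h => exact .el ⟨_, h, rfl⟩

theorem Provable.dia_mono (h : Provable Ax ∅ (imp φ ψ)) :
    Provable Ax Γ (imp (dia φ) (dia ψ)) :=
  .mp (.nec h) (dia_imp φ ψ)

theorem Provable.box_mono (h : Provable Ax ∅ (imp φ ψ)) :
    Provable Ax Γ (imp (box φ) (box ψ)) :=
  .mp (.nec h) (box_imp φ ψ)

/-- Compactness in the form Zorn's lemma needs: a derivation uses finitely many premises, and these
lie in one member of the chain. -/
theorem Provable.exists_mem_chain {c : Set (Set Form)} (hc : IsChain (· ⊆ ·) c)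
    (hne : c.Nonempty) (h : Provable Ax (⋃₀ c) φ) : ∃ T ∈ c, Provable Ax T φ := by
  generalize hΔ : ⋃₀ c = Δ at h
  obtain ⟨T₀, hT₀⟩ := hne
  induction h with
  | ax h => exact ⟨T₀, hT₀, .ax h⟩
  | mp _ _ ih₁ ih₂ =>
    obtain ⟨T₁, h₁, p₁⟩ := ih₁ hΔ
    obtain ⟨T₂, h₂, p₂⟩ := ih₂ hΔ
    rcases hc.total h₁ h₂ with h | h
    · exact ⟨T₂, h₂, .mp (p₁.mono h) p₂⟩
    · exact ⟨T₁, h₁, .mp p₁ (p₂.mono h)⟩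
  | nec h _ => exact ⟨T₀, hT₀, .nec h⟩
  | el h =>
    subst hΔ
    obtain ⟨T, hT, h⟩ := h
    exact ⟨T, hT, .el h⟩

end Derivations

/-! ### Theories -/

section Theories

variable {Ax Γ Δ : Set Form} {φ ψ : Form}

/-- Deductively closed sets of formulas. -/
def IsTheory (Ax T : Set Form) : Prop := ∀ φ, Provable Ax T φ → φ ∈ T

/-- Prime theories; the inconsistent theory is one of them. -/
structure IsPrimeTheory (Ax T : Set Form) : Prop where
  isTheory : IsTheory Ax T
  or_mem : ∀ φ ψ : Form, or φ ψ ∈ T → φ ∈ T ∨ ψ ∈ T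

theorem IsTheory.mp (h : IsTheory Ax Γ) (hφ : φ ∈ Γ) (hi : Provable Ax Γ (imp φ ψ)) : ψ ∈ Γ :=
  h _ (.mp (.el hφ) hi)

theorem IsTheory.eq_univ (h : IsTheory Ax Γ) (hb : bot ∈ Γ) : Γ = Set.univ :=
  Set.eq_univ_of_forall fun φ => h.mp hb (.exfalso φ)

theorem isTheory_consequences (Ax Γ : Set Form) : IsTheory Ax {φ | Provable Ax Γ φ} :=
  fun _ h => h.cut fun _ hδ => hδ

theorem isPrimeTheory_univ (Ax : Set Form) : IsPrimeTheory Ax Set.univ :=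
  ⟨fun _ _ => trivial, fun _ _ _ => Or.inl trivial⟩

theorem IsTheory.box_mem (hΓ : IsTheory Ax Γ) (h : Provable Ax {ψ | box ψ ∈ Γ} φ) :
    box φ ∈ Γ :=
  hΓ _ (h.box_image.mono (by rintro _ ⟨ψ, hψ, rfl⟩; exact hψ))

/-- Finitely many premises from the image of a theory under a monotone operator reduce to one. -/
theorem Provable.exists_mem_theory {f : Form → Form}
    (hf : ∀ a b, Provable Ax ∅ (imp a b) → Provable Ax Γ (imp (f a) (f b)))
    (hΔ : IsTheory Ax Δ) (h : Provable Ax (Γ ∪ f '' Δ) φ) :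
    ∃ δ ∈ Δ, Provable Ax Γ (imp (f δ) φ) := by
  have htop : imp bot bot ∈ Δ := hΔ _ (.imp_self _)
  generalize hΘ : Γ ∪ f '' Δ = Θ at h
  induction h with
  | ax h => exact ⟨_, htop, weaken (.ax h) _⟩
  | mp _ _ ih₁ ih₂ =>
    obtain ⟨a, ha, pa⟩ := ih₁ hΘ
    obtain ⟨b, hb, pb⟩ := ih₂ hΘ
    refine ⟨and a b, hΔ _ (.mp (.el hb) (.mp (.el ha) (pair a b))), ?_⟩
    exact .mp ((hf _ _ (fst a b)).trans pa) (.mp ((hf _ _ (snd a b)).trans pb) (distrib _ _ _))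
  | nec h _ => exact ⟨_, htop, weaken (.nec h) _⟩
  | el h =>
    subst hΘ
    rcases h with h | ⟨δ, hδ, rfl⟩
    · exact ⟨_, htop, weaken (.el h) _⟩
    · exact ⟨δ, hδ, imp_self _⟩

/-- The premises from `Δ` merge into one `δ`, so `□(δ → φ) ∈ Γ`, and the diamond form of K applies
to `◇δ ∈ Γ`. -/
theorem IsTheory.dia_mem (hΓ : IsTheory Ax Γ) (hΔ : IsTheory Ax Δ)
    (hd : ∀ δ ∈ Δ, dia δ ∈ Γ) (h : Provable Ax ({ψ | box ψ ∈ Γ} ∪ Δ) φ) : dia φ ∈ Γ := by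
  obtain ⟨δ, hδ, hp⟩ := Provable.exists_mem_theory (f := id)
    (fun _ _ h => h.mono (Set.empty_subset _)) hΔ (by simpa using h)
  exact hΓ.mp (hd δ hδ) (.mp (.el (hΓ.box_mem hp)) (.dia_imp _ _))

/-- A set of formulas that is directed with respect to provable implication. -/
def IsDirected (Ax I : Set Form) : Prop :=
  ∀ a ∈ I, ∀ b ∈ I, ∃ c ∈ I, Provable Ax ∅ (imp a c) ∧ Provable Ax ∅ (imp b c)

/-- Take a maximal set proving no member of `I`. If it contained `φ ∨ ψ` but neither disjunct, each
disjunct would imply a member of `I`, and a common upper bound in `I` would be provable. -/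
theorem exists_isPrimeTheory {I : Set Form} (hI : IsDirected Ax I)
    (h : ∀ i ∈ I, ¬ Provable Ax Γ i) :
    ∃ T, IsPrimeTheory Ax T ∧ Γ ⊆ T ∧ ∀ i ∈ I, i ∉ T := by
  obtain ⟨T, hΓT, hT⟩ := zorn_subset_nonempty {T | ∀ i ∈ I, ¬ Provable Ax T i}
    (fun c hcS hc hne => ⟨⋃₀ c, fun i hi hp => by
      obtain ⟨T, hT, hp⟩ := hp.exists_mem_chain hc hne
      exact hcS hT i hi hp, fun _ hs => Set.subset_sUnion_of_mem hs⟩) Γ h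
  have key : ∀ φ, φ ∉ T → ∃ i ∈ I, Provable Ax T (imp φ i) := by
    intro φ hφ
    by_contra! hcon
    exact hφ (hT.le_of_ge (y := insert φ T) (fun i hi hp => hcon i hi hp.deduction)
      (Set.subset_insert _ _) (Set.mem_insert _ _))
  refine ⟨T, ⟨fun φ hφ => ?_, fun φ ψ hor => ?_⟩, hΓT, fun i hi hiT => hT.prop i hi (.el hiT)⟩
  · by_contra hn
    obtain ⟨i, hi, hp⟩ := key φ hn
    exact hT.prop i hi (.mp hφ hp)
  · by_contra! hn
    obtain ⟨a, ha, pa⟩ := key φ hn.1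
    obtain ⟨b, hb, pb⟩ := key ψ hn.2
    obtain ⟨c, hc, hac, hbc⟩ := hI a ha b hb
    have hac' := pa.trans (hac.mono (Set.empty_subset _))
    have hbc' := pb.trans (hbc.mono (Set.empty_subset _))
    exact hT.prop c hc (.mp (.el hor) (.mp hbc' (.mp hac' (.cases _ _ _))))

theorem isDirected_singleton (Ax : Set Form) (φ : Form) : IsDirected Ax {φ} := by
  rintro _ rfl _ rfl
  exact ⟨_, rfl, .imp_self _, .imp_self _⟩

theorem IsPrimeTheory.isDirected_box (hΔ : IsPrimeTheory Ax Δ) :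
    IsDirected Ax (box '' Δᶜ) := by
  rintro _ ⟨a, ha, rfl⟩ _ ⟨b, hb, rfl⟩
  exact ⟨_, ⟨or a b, fun h => (hΔ.or_mem _ _ h).elim ha hb, rfl⟩,
    .box_mono (.inl a b), .box_mono (.inr a b)⟩

theorem IsPrimeTheory.isDirected_dia (hΓ : IsPrimeTheory Ax Γ) (hC : axC ∈ Ax) :
    IsDirected Ax {φ | dia φ ∉ Γ} := by
  intro a ha b hb
  refine ⟨or a b, fun h => ?_, .inl a b, .inr a b⟩
  exact (hΓ.or_mem _ _ (hΓ.isTheory.mp h (Provable.of_mem_ax hC a b b))).elim ha hb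

theorem IsTheory.bot_mem_of_dia (hΓ : IsTheory Ax Γ) (hN : axN ∈ Ax) (h : dia bot ∈ Γ) :
    bot ∈ Γ :=
  hΓ.mp h (Provable.of_mem_ax hN bot bot bot)

/-- Extend `Γ ∪ ◇Δ` while avoiding every `□φ` with `φ ∉ Δ`. A failure would give `◇δ → □φ` in `Γ`
for some `δ ∈ Δ`; then `axI` puts `□(δ → φ)` in `Γ`, hence `φ` in `Δ`. -/
theorem exists_isPrimeTheory_dia (hI : axI ∈ Ax) (hΓ : IsTheory Ax Γ)
    (hΔ : IsPrimeTheory Ax Δ) (h : ∀ φ, box φ ∈ Γ → φ ∈ Δ) :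
    ∃ T, IsPrimeTheory Ax T ∧ Γ ⊆ T ∧ (∀ δ ∈ Δ, dia δ ∈ T) ∧ ∀ φ, box φ ∈ T → φ ∈ Δ := by
  obtain ⟨T, hT, hsub, hbox⟩ := exists_isPrimeTheory (Γ := Γ ∪ dia '' Δ) hΔ.isDirected_box (by
    rintro _ ⟨φ, hφ, rfl⟩ hp
    obtain ⟨δ, hδ, hp⟩ := Provable.exists_mem_theory (fun _ _ h => h.dia_mono) hΔ.isTheory hp
    have hb := hΓ _ (.mp hp (Provable.of_mem_ax hI δ φ φ))
    exact hφ (hΔ.isTheory.mp hδ (.el (h _ hb))))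
  exact ⟨T, hT, fun _ hφ => hsub (Or.inl hφ), fun δ hδ => hsub (Or.inr ⟨δ, hδ, rfl⟩),
    fun φ hφ => by_contra fun hn => hbox _ ⟨φ, hn, rfl⟩ hφ⟩

end Theories

/-! ### The canonical frame -/

/-- A segment: a prime theory with a set of prime theories serving as its modal successors. -/
@[ext]
structure Segment (Ax : Set Form) : Type u where
  head : Set Form
  tail : Set (Set Form)
  head_prime : IsPrimeTheory Ax head
  tail_prime : ∀ Δ ∈ tail, IsPrimeTheory Ax Δ
  box_mem : ∀ Δ ∈ tail, ∀ φ, box φ ∈ head → φ ∈ Δ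
  dia_mem : ∀ Δ, IsTheory Ax Δ → (∀ δ ∈ Δ, dia δ ∈ head) → ∃ Θ ∈ tail, Δ ⊆ Θ
  bot_mem : axN ∈ Ax → Set.univ ∈ tail → bot ∈ head

namespace Segment

variable {Ax : Set Form}

instance : Preorder (Segment.{u} Ax) := Preorder.lift head

/-- The exploding segment. -/
def expl (Ax : Set Form) : Segment.{u} Ax where
  head := Set.univ
  tail := {Set.univ}
  head_prime := isPrimeTheory_univ Ax
  tail_prime := by rintro _ rfl; exact isPrimeTheory_univ Ax
  box_mem := by rintro _ rfl _ _; trivial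
  dia_mem := fun _ _ _ => ⟨_, rfl, Set.subset_univ _⟩
  bot_mem := fun _ _ => trivial

theorem eq_expl {s : Segment.{u} Ax} (h : bot ∈ s.head) : s = expl Ax := by
  have hu := s.head_prime.isTheory.eq_univ h
  have ht : ∀ Δ ∈ s.tail, Δ = Set.univ := fun Δ hΔ =>
    (s.tail_prime Δ hΔ).isTheory.eq_univ (s.box_mem Δ hΔ bot (hu ▸ trivial))
  -- Only nonemptiness of the tail is needed here; its members are already known to be `Set.univ`.
  obtain ⟨Θ, hΘ, -⟩ := s.dia_mem Set.univ (isPrimeTheory_univ Ax).isTheory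
    (fun _ _ => hu ▸ trivial)
  refine Segment.ext hu (Set.eq_singleton_iff_unique_mem.2 ⟨?_, ht⟩)
  exact ht Θ hΘ ▸ hΘ

/-- The segment over `Γ` whose tail consists of the prime theories that contain `□⁻¹Γ` and
avoid `I`. -/
def avoiding (Γ I : Set Form) (hΓ : IsPrimeTheory Ax Γ) (hI : IsDirected Ax I)
    (hdia : ∀ i ∈ I, dia i ∉ Γ) (hN : axN ∈ Ax → I = ∅ → bot ∈ Γ) : Segment.{u} Ax where
  head := Γ
  tail := {Θ | IsPrimeTheory Ax Θ ∧ (∀ φ, box φ ∈ Γ → φ ∈ Θ) ∧ ∀ i ∈ I, i ∉ Θ}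
  head_prime := hΓ
  tail_prime := fun _ h => h.1
  box_mem := fun _ h => h.2.1
  dia_mem := fun Δ hΔ hd => by
    obtain ⟨Θ, hΘ, hsub, hav⟩ := exists_isPrimeTheory (Γ := {ψ | box ψ ∈ Γ} ∪ Δ) hI
      (fun i hi hp => hdia i hi (hΓ.isTheory.dia_mem hΔ hd hp))
    exact ⟨Θ, ⟨hΘ, fun φ hφ => hsub (Or.inl hφ), hav⟩, fun φ hφ => hsub (Or.inr hφ)⟩
  bot_mem := fun h hu => hN h (Set.eq_empty_iff_forall_notMem.2 fun i hi => hu.2.2 i hi trivial)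

/-- The segment over `Γ` with the largest tail. -/
def full (Γ : Set Form) (hΓ : IsPrimeTheory Ax Γ) : Segment.{u} Ax :=
  -- The avoided set is `{⊥}` when `bot_mem` forbids `Set.univ` in the tail, and empty otherwise.
  avoiding Γ {φ | φ = bot ∧ axN ∈ Ax ∧ bot ∉ Γ} hΓ
    (by rintro _ ⟨rfl, h⟩ _ ⟨rfl, -⟩; exact ⟨bot, ⟨rfl, h⟩, .imp_self _, .imp_self _⟩)
    (by rintro _ ⟨rfl, hN, hb⟩ h; exact hb (hΓ.isTheory.bot_mem_of_dia hN h))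
    (fun hN h => by_contra fun hb => (h ▸ (⟨rfl, hN, hb⟩ : _ ∧ _ ∧ _) : bot ∈ (∅ : Set Form)))

theorem mem_tail_full {Γ Θ : Set Form} {hΓ : IsPrimeTheory Ax Γ} (hΘ : IsPrimeTheory Ax Θ)
    (h : ∀ φ, box φ ∈ Γ → φ ∈ Θ) (hb : bot ∉ Θ) : Θ ∈ (full.{u} Γ hΓ).tail :=
  ⟨hΘ, h, by rintro _ ⟨rfl, -⟩; exact hb⟩

end Segment

/-- The canonical frame of `CK ⊕ Ax`. -/
def canonicalFrame (Ax : Set Form) : CKFrame.{u} where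
  World := Segment.{u} Ax
  expl := Segment.expl Ax
  R s t := t.head ∈ s.tail
  eq_expl_of_le := fun _ h => Segment.eq_expl ((show Set.univ ⊆ Segment.head _ from h) trivial)
  expl_R_iff := fun x => ⟨fun h => Segment.eq_expl ((show x.head = Set.univ from h) ▸ trivial),
    by rintro rfl; exact rfl⟩

/-- The canonical valuation. -/
def canonicalValuation (Ax : Set Form) : Valuation (canonicalFrame.{u} Ax) where
  val p := {s : Segment.{u} Ax | var p ∈ s.head}
  isUpperSet := fun _ _ _ hst hs => hst hs
  expl_mem := fun _ => trivial

theorem forces_canonical_iff {Ax : Set Form} (φ : Form) (s : Segment.{u} Ax) :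
    Forces (canonicalFrame.{u} Ax) (canonicalValuation Ax) s φ ↔ φ ∈ s.head := by
  induction φ generalizing s with
  | var p => rfl
  | bot => exact ⟨fun h => (show s = Segment.expl Ax from h) ▸ trivial, Segment.eq_expl⟩
  | and φ ψ ihφ ihψ =>
    have hs := s.head_prime.isTheory
    refine (and_congr (ihφ s) (ihψ s)).trans ⟨fun h => ?_, fun h => ?_⟩
    · exact hs _ (.mp (.el h.2) (.mp (.el h.1) (.pair φ ψ)))
    · exact ⟨hs.mp h (.fst φ ψ), hs.mp h (.snd φ ψ)⟩
  | or φ ψ ihφ ihψ =>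
    have hs := s.head_prime.isTheory
    refine (or_congr (ihφ s) (ihψ s)).trans ⟨fun h => ?_, s.head_prime.or_mem φ ψ⟩
    exact h.elim (fun h => hs.mp h (.inl φ ψ)) fun h => hs.mp h (.inr φ ψ)
  | imp φ ψ ihφ ihψ =>
    constructor
    · intro h
      by_contra hn
      obtain ⟨T, hT, hsub, hav⟩ := exists_isPrimeTheory (Γ := insert φ s.head)
        (isDirected_singleton Ax ψ)
        (by rintro _ rfl hp; exact hn (s.head_prime.isTheory _ hp.deduction))
      have hψ := h (Segment.full T hT) (fun _ hx => hsub (Or.inr hx))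
        ((ihφ _).2 (hsub (Or.inl rfl)))
      exact hav ψ rfl ((ihψ _).1 hψ)
    · intro h t hst hφ
      exact (ihψ t).2 (t.head_prime.isTheory.mp ((ihφ t).1 hφ) (.el (hst h)))
  | box φ ih =>
    constructor
    · intro h
      by_contra hn
      obtain ⟨Θ, hΘ, hsub, hav⟩ := exists_isPrimeTheory (Γ := {ψ | box ψ ∈ s.head})
        (isDirected_singleton Ax φ)
        (by rintro _ rfl hp; exact hn (s.head_prime.isTheory.box_mem hp))
      have hb : bot ∉ Θ := fun hb => hav φ rfl (hΘ.isTheory.mp hb (.exfalso φ))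
      have hφ := h (Segment.full s.head s.head_prime) (Segment.full Θ hΘ) (fun _ hx => hx)
        (Segment.mem_tail_full hΘ (fun ψ hψ => hsub hψ) hb)
      exact hav φ rfl ((ih _).1 hφ)
    · intro h t z hst htz
      exact (ih z).2 (t.box_mem _ htz φ (hst h))
  | dia φ ih =>
    constructor
    · intro h
      by_contra hn
      obtain ⟨z, hz, hφ⟩ := h (Segment.avoiding s.head {φ} s.head_prime
        (isDirected_singleton Ax φ) (by rintro _ rfl; exact hn)
        (fun _ h => absurd h (Set.singleton_ne_empty φ))) (fun _ hx => hx)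
      exact hz.2.2 φ rfl ((ih z).1 hφ)
    · intro h t hst
      obtain ⟨Θ, hΘ, hsub⟩ := t.dia_mem {ψ | Provable Ax {φ} ψ} (isTheory_consequences Ax {φ})
        (fun ψ hψ => t.head_prime.isTheory.mp (hst h)
          (Provable.dia_mono (Provable.deduction (by simpa using hψ))))
      exact ⟨Segment.full Θ (t.tail_prime Θ hΘ), hΘ, (ih _).2 (hsub (.el rfl))⟩

theorem NSuff.nCorr {F : CKFrame.{u}} (h : NSuff F) : NCorr F := fun x hx => h x (hx x le_rfl)

theorem nSuff_canonicalFrame {Ax : Set Form} (hN : axN ∈ Ax) : NSuff (canonicalFrame.{u} Ax) :=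
  fun s h => Segment.eq_expl (Segment.bot_mem s hN h)

theorem cSuff_canonicalFrame {Ax : Set Form} (hC : axC ∈ Ax) :
    CSuff (canonicalFrame.{u} Ax) := by
  intro (s : Segment.{u} Ax)
  -- With this tail, every successor `z` satisfies `◇δ ∈ s.head` for all `δ ∈ z.head`, which is what
  -- `dia_mem` needs at any `t` above `s`.
  refine ⟨Segment.avoiding s.head {φ | dia φ ∉ s.head} s.head_prime
    (s.head_prime.isDirected_dia hC) (fun _ h => h) (fun hN h => ?_), fun _ hx => hx, ?_⟩
  · refine s.head_prime.isTheory.bot_mem_of_dia hN (by_contra fun hn => ?_)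
    exact (h ▸ hn : bot ∈ (∅ : Set Form))
  · intro (t : Segment.{u} Ax) (z : Segment.{u} Ax) hst hz
    obtain ⟨Θ, hΘ, hsub⟩ := t.dia_mem z.head z.head_prime.isTheory
      (fun δ hδ => hst (by_contra fun hn => hz.2.2 δ hn hδ))
    exact ⟨Segment.full Θ (t.tail_prime Θ hΘ), hΘ, hsub⟩

theorem iSuff_canonicalFrame {Ax : Set Form} (hI : axI ∈ Ax) :
    ISuff (canonicalFrame.{u} Ax) := by
  intro (s : Segment.{u} Ax) (y : Segment.{u} Ax) (z : Segment.{u} Ax) hsy hyz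
  -- A full tail may omit `Set.univ`, so an exploding `z` is handled separately, with the exploding
  -- world as `u`.
  by_cases hb : bot ∈ z.head
  · obtain rfl := Segment.eq_expl hb
    refine ⟨Segment.expl Ax, fun _ _ => trivial, rfl, fun t ht => ⟨Segment.expl Ax, ?_, le_rfl⟩⟩
    obtain rfl : t = Segment.expl Ax := Segment.eq_expl (ht trivial)
    exact rfl
  · obtain ⟨T, hT, hsub, hdia, hbox⟩ := exists_isPrimeTheory_dia hI s.head_prime.isTheory
      z.head_prime (fun φ hφ => hyz (s.box_mem _ hsy φ hφ))
    refine ⟨Segment.full T hT, hsub, Segment.mem_tail_full z.head_prime hbox hb, ?_⟩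
    intro (t : Segment.{u} Ax) ht
    obtain ⟨Θ, hΘ, hzΘ⟩ := t.dia_mem z.head z.head_prime.isTheory (fun δ hδ => ht (hdia δ hδ))
    exact ⟨Segment.full Θ (t.tail_prime Θ hΘ), hΘ, hzΘ⟩

theorem canonicalFrame_mem_frameClass (Ax : Set Form) :
    canonicalFrame.{u} Ax ∈ frameClass.{u} Ax := by
  refine ⟨fun hN => ?_, cSuff_canonicalFrame, iSuff_canonicalFrame⟩
  split_ifs
  · exact (nSuff_canonicalFrame hN).nCorr
  · exact nSuff_canonicalFrame hN

theorem provable_of_entails {Ax Γ : Set Form} {φ : Form}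
    (h : Entails.{u} (frameClass.{u} Ax) Γ φ) : Provable Ax Γ φ := by
  by_contra hn
  obtain ⟨T, hT, hsub, hav⟩ := exists_isPrimeTheory (isDirected_singleton Ax φ)
    (by rintro _ rfl; exact hn)
  have := h _ (canonicalFrame_mem_frameClass Ax) (canonicalValuation Ax) (Segment.full T hT)
    (fun ψ hψ => (forces_canonical_iff ψ _).2 (hsub hψ))
  exact hav φ rfl ((forces_canonical_iff φ _).1 this)

/-! ### Soundness -/

section Soundness

variable {F : CKFrame.{u}} {V : Valuation F}

theorem Forces.mono {φ : Form} {x y : F.World} (hxy : x ≤ y) (h : Forces F V x φ) :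
    Forces F V y φ := by
  induction φ with
  | var p => exact V.isUpperSet p hxy h
  | bot => exact F.eq_expl_of_le y ((show x = F.expl from h) ▸ hxy)
  | and φ ψ ihφ ihψ => exact ⟨ihφ h.1, ihψ h.2⟩
  | or φ ψ ihφ ihψ => exact h.imp ihφ ihψ
  | imp φ ψ _ _ => exact fun z hz => h z (hxy.trans hz)
  | box φ _ => exact fun z w hz => h z w (hxy.trans hz)
  | dia φ _ => exact fun z hz => h z (hxy.trans hz)

theorem forces_expl (φ : Form) : Forces F V F.expl φ := by
  induction φ with
  | var p => exact V.expl_mem p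
  | bot => rfl
  | and φ ψ ihφ ihψ => exact ⟨ihφ, ihψ⟩
  | or φ ψ ihφ _ => exact Or.inl ihφ
  | imp φ ψ _ ihψ =>
    intro y hy _
    rwa [F.eq_expl_of_le y hy]
  | box φ ih =>
    intro y z hy hz
    rw [F.eq_expl_of_le y hy] at hz
    rwa [(F.expl_R_iff z).1 hz]
  | dia φ ih =>
    intro y hy
    exact ⟨F.expl, by rw [F.eq_expl_of_le y hy, F.expl_R_iff], ih⟩

theorem forces_of_mem_intAx {A : Form} (hA : A ∈ IntAx) (σ : ℕ → Form) (x : F.World) :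
    Forces F V x (A.subst σ) := by
  simp only [IntAx, Set.mem_insert_iff, Set.mem_singleton_iff] at hA
  rcases hA with rfl | rfl | rfl | rfl | rfl | rfl | rfl | rfl | rfl
  · exact fun y _ hp z hz _ => hp.mono hz
  · exact fun y _ h z hz g w hw hp => h w (hz.trans hw) hp w le_rfl (g w hw hp)
  · exact fun y _ hp z hz hq => ⟨hp.mono hz, hq⟩
  · exact fun y _ h => h.1
  · exact fun y _ h => h.2
  · exact fun y _ h => Or.inl h
  · exact fun y _ h => Or.inr h
  · exact fun y _ h z hz g w hw hpq => hpq.elim (h w (hz.trans hw)) (g w hw)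
  · intro y _ h
    obtain rfl : y = F.expl := h
    exact forces_expl _

theorem forces_axKbox (σ : ℕ → Form) (x : F.World) : Forces F V x (axKbox.subst σ) :=
  fun _ _ h _ hz g w v hw hv => h w v (hz.trans hw) hv v le_rfl (g w v hw hv)

theorem forces_axKdia (σ : ℕ → Form) (x : F.World) : Forces F V x (axKdia.subst σ) := by
  intro y _ h z hz g w hw
  obtain ⟨v, hv, hp⟩ := g w hw
  exact ⟨v, hv, h w v (hz.trans hw) hv v le_rfl hp⟩

theorem forces_axN (hF : NCorr F) (σ : ℕ → Form) (x : F.World) :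
    Forces F V x (axN.subst σ) := by
  intro y _ h
  refine hF y fun z hz => ?_
  obtain ⟨w, hw, hb⟩ := h z hz
  obtain rfl : w = F.expl := hb
  exact hw

theorem forces_axC (hF : CSuff F) (σ : ℕ → Form) (x : F.World) :
    Forces F V x (axC.subst σ) := by
  intro y _ h
  obtain ⟨y', hy', hR⟩ := hF y
  -- The successor `z` of `y'` fixes the disjunct once; every world above `y` then sees something
  -- above `z`.
  obtain ⟨z, hz, hpq⟩ := h y' hy'
  have key : ∀ ψ, Forces F V z ψ → Forces F V y (dia ψ) := fun ψ hψ w hw => by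
    obtain ⟨v, hv, hzv⟩ := hR w z hw hz
    exact ⟨v, hv, hψ.mono hzv⟩
  exact hpq.imp (key _) (key _)

theorem forces_axI (hF : ISuff F) (σ : ℕ → Form) (x : F.World) :
    Forces F V x (axI.subst σ) := by
  intro y _ h w v hyw hwv z hvz hp
  obtain ⟨s, hws, hsz, hs⟩ := hF w v z hwv hvz
  -- The world `s` forces `◇p`, as all worlds above it see something above `z`. Hence it forces
  -- `□q`, and it sees `z` itself.
  refine h s (hyw.trans hws) (fun r hr => ?_) s z le_rfl hsz
  obtain ⟨t, ht, hzt⟩ := hs r hr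
  exact ⟨t, ht, hp.mono hzt⟩

theorem entails_of_provable {Ax Γ : Set Form} (hAx : Ax ⊆ {axN, axC, axI}) {φ : Form}
    (h : Provable Ax Γ φ) : Entails.{u} (frameClass.{u} Ax) Γ φ := by
  rintro F ⟨hN, hC, hI⟩ V
  induction h with
  | ax h =>
    intro x _
    rcases h with ⟨A, hA | rfl | rfl, σ, rfl⟩ | ⟨A, hA, σ, rfl⟩
    · exact forces_of_mem_intAx hA σ x
    · exact forces_axKbox σ x
    · exact forces_axKdia σ x
    · rcases hAx hA with rfl | rfl | rfl
      · refine forces_axN ?_ σ x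
        have := hN hA
        split_ifs at this
        · exact this
        · exact this.nCorr
      · exact forces_axC (hC hA) σ x
      · exact forces_axI (hI hA) σ x
  | mp _ _ ih₁ ih₂ => exact fun x hx => ih₂ x hx x le_rfl (ih₁ x hx)
  | nec _ ih => exact fun x _ y z _ _ => ih z (by simp)
  | el h => exact fun x hx => hx _ h

end Soundness

end ConstructiveK

theorem mainTheorem3 (Ax : Set ConstructiveK.Form)
    (hAx : Ax ⊆ {ConstructiveK.axN, ConstructiveK.axC, ConstructiveK.axI}) :
    (∀ (Γ : Set ConstructiveK.Form) (φ : ConstructiveK.Form),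
      ConstructiveK.Provable Ax Γ φ →
        ConstructiveK.Entails.{u} (ConstructiveK.frameClass.{u} Ax) Γ φ) ∧
    (∀ (Γ : Set ConstructiveK.Form) (φ : ConstructiveK.Form),
      ConstructiveK.Entails.{u} (ConstructiveK.frameClass.{u} Ax) Γ φ →
        ConstructiveK.Provable Ax Γ φ) :=
  ⟨fun _ _ => ConstructiveK.entails_of_provable hAx,
    fun _ _ => ConstructiveK.provable_of_entails⟩
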